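/- Consider a reverse auction with a finite set $L$ of bidders and $t$ types of goods, where $\{A^\tau\}_{\tau=1}^t$ is a partition of $L$ ($A^\tau$ is the set of bidders offering goods of type $\tau$), and put $A^T=\bigcup_{\tau\in T}A^\tau$ for $T\subseteq[t]=\{1,\dots,t\}$. Each bidder $l\in L$ has a cost function $c_l:\mathbb{R}_+\to\mathbb{R}_+$ with $c_l(0)=0$ and a capacity $\bar X_l\in\mathbb{R}_+$. Let $M:2^{[t]}\to\mathbb{R}_+$ with $M(\emptyset)=0$. For every $S\subseteq L$ let $$J(S)=\min_{x\in\mathbb{R}_+^{L}}\ \sum_{l\in S}c_l(x_l)\quad\text{s.t.}\quad \sum_{l\in A^T}x_l\ge M(T)\ \ \forall\, T\subseteq[t],\qquad x_l\le\bar X_l\ \ \forall\, l\in L,\qquad x_l=0\ \ \forall\, l\in L\setminus S,$$ with $J(S)=\infty$ if the problem is infeasible. Suppose that every $c_l$ is nondecreasing and convex, and that $M$ is nondecreasing ($M(T')\le M(T)$ for $T'\subseteq T$) and supermodular ($M(T)+M(T')\le M(T\cup T')+M(T\cap T')$ for all $T,T'\subseteq[t]$). Then the minimum is attained whenever the problem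 is feasible, and $J$ is supermodular: $J(S)+J(R)\le J(S\cup R)+J(S\cap R)$ for all $S,R\subseteq L$ (an inequality in $[0,\infty]$). -/

import Mathlib

open scoped NNReal ENNReal

/-- A set function `f` on the subsets of a finite set is supermodular if
`f S + f R ≤ f (S ∪ R) + f (S ∩ R)` for all `S`, `R`. It is used for `ℝ≥0`-valued and, when the
value `∞` of an infeasible problem is allowed, for `ℝ≥0∞`-valued functions. -/
def IsSupermodular {α β : Type*} [DecidableEq α] [Add β] [LE β] (f : Finset α → β) : Prop :=
  ∀ S R : Finset α, f S + f R ≤ f (S ∪ R) + f (S ∩ R)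

/-- The feasible allocations `x : L → ℝ₊` of the market when only the bidders in `S` take part:
the bidders of the types in `T` together supply at least `M T`, for every set `T` of types; no
bidder exceeds its capacity `X l`; bidders outside `S` supply nothing. Here `A τ` is the set of
bidders of type `τ`, so that `T.biUnion A` is the set of bidders whose type is in `T`. -/
def marketFeasible {L : Type*} [DecidableEq L] {t : ℕ} (A : Fin t → Finset L)
    (M : Finset (Fin t) → ℝ≥0) (X : L → ℝ≥0) (S : Finset L) : Set (L → ℝ≥0) :=
  {x | (∀ T : Finset (Fin t), M T ≤ ∑ l ∈ T.biUnion A, x l) ∧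
    (∀ l, x l ≤ X l) ∧ ∀ l, l ∉ S → x l = 0}

/-- The optimal value `J(C_S)` of the market with the bidders in `S`: the least total cost
`∑ l ∈ S, c l (x l)` of a feasible allocation, and `∞` if there is none. -/
noncomputable def marketValue {L : Type*} [DecidableEq L] {t : ℕ} (A : Fin t → Finset L)
    (M : Finset (Fin t) → ℝ≥0) (X : L → ℝ≥0) (c : L → ℝ≥0 → ℝ≥0) (S : Finset L) : ℝ≥0∞ :=
  ⨅ x ∈ marketFeasible A M X S, ((∑ l ∈ S, c l (x l) : ℝ≥0) : ℝ≥0∞)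

/-! Take optimal `x` for `S ∪ R` and `y` for `S ∩ R`. It suffices to find `z` feasible for `S` with
`w = x + y - z` feasible for `R` and `z` pointwise between `x` and `y`: convexity then bounds the
cost bidder by bidder. Demand for `z` and `w` reads `M T ≤ z(A^T) ≤ (x + y)(A^T) - M T`, a
supermodular lower and a submodular upper bound on the block sums of `z`, which also lie in
intervals. `exists_modular_between` supplies such sums, `exists_of_block_sums` splits them among
bidders, and `marketFeasible.exchange` combines the two. Optimal allocations exist by compactness
and continuity of the costs. -/

/-! ### Sandwich theorem with bounds on the weights -/

/-- Contribution of the element `i` to `lo (U \ T) - hi (T \ U)`. -/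
def boxGap {α : Type*} [DecidableEq α] (lo hi : α → ℝ) (T U : Finset α) (i : α) : ℝ :=
  if i ∈ U then (if i ∈ T then 0 else lo i) else (if i ∈ T then -hi i else 0)

/-- Comparable membership pairs of `i` give equality. The only incomparable case, `i` in `T \ U` and
in `U' \ T'` or vice versa, gives `lo i - hi i ≤ 0`. -/
theorem boxGap_uncross {α : Type*} [DecidableEq α] {lo hi : α → ℝ} {i : α} (h : lo i ≤ hi i)
    (T T' U U' : Finset α) :
    boxGap lo hi T U i + boxGap lo hi T' U' i ≤
      boxGap lo hi (T ∪ T') (U ∪ U') i + boxGap lo hi (T ∩ T') (U ∩ U') i := by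
  simp only [boxGap, Finset.mem_union, Finset.mem_inter]
  by_cases h1 : i ∈ T <;> by_cases h2 : i ∈ T' <;> by_cases h3 : i ∈ U <;>
    by_cases h4 : i ∈ U' <;> simp only [h1, h2, h3, h4, if_true, if_false, or_true,
      or_false, and_true, and_false] <;> norm_num <;> linarith

theorem sum_boxGap {α : Type*} [DecidableEq α] (lo hi : α → ℝ) {T U V : Finset α}
    (hT : T ⊆ V) (hU : U ⊆ V) :
    ∑ i ∈ V, boxGap lo hi T U i = ∑ i ∈ U \ T, lo i - ∑ i ∈ T \ U, hi i := by
  have h1 : U \ T = V.filter (fun i => i ∈ U ∧ i ∉ T) := by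
    ext i; simp only [Finset.mem_sdiff, Finset.mem_filter]; grind
  have h2 : T \ U = V.filter (fun i => i ∈ T ∧ i ∉ U) := by
    ext i; simp only [Finset.mem_sdiff, Finset.mem_filter]; grind
  rw [h1, h2, Finset.sum_filter, Finset.sum_filter, ← Finset.sum_sub_distrib]
  refine Finset.sum_congr rfl fun i _ => ?_
  by_cases hiT : i ∈ T <;> by_cases hiU : i ∈ U <;> simp [boxGap, hiT, hiU]

theorem sum_boxGap_congr {α : Type*} [DecidableEq α] (lo hi : α → ℝ) {T T' U U' V : Finset α}
    (hT : ∀ i ∈ V, (i ∈ T ↔ i ∈ T')) (hU : ∀ i ∈ V, (i ∈ U ↔ i ∈ U')) :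
    ∑ i ∈ V, boxGap lo hi T U i = ∑ i ∈ V, boxGap lo hi T' U' i :=
  Finset.sum_congr rfl fun i hi' => by simp only [boxGap, hT i hi', hU i hi']

/-- Contraction of a supermodular function at an element whose weight is fixed to be `r`. -/
theorem supermodular_contract {α : Type*} [DecidableEq α] {V : Finset α} {k : α} (hk : k ∉ V)
    {f : Finset α → ℝ}
    (hf : ∀ T ⊆ insert k V, ∀ T' ⊆ insert k V, f T + f T' ≤ f (T ∪ T') + f (T ∩ T')) (r : ℝ)
    {T T' : Finset α} (hT : T ⊆ V) (hT' : T' ⊆ V) :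
    max (f T) (f (insert k T) - r) + max (f T') (f (insert k T') - r) ≤
      max (f (T ∪ T')) (f (insert k (T ∪ T')) - r) +
        max (f (T ∩ T')) (f (insert k (T ∩ T')) - r) := by
  have hkT : k ∉ T := fun h => hk (hT h)
  have hkT' : k ∉ T' := fun h => hk (hT' h)
  have s1 : T ⊆ insert k V := hT.trans (Finset.subset_insert _ _)
  have s2 : T' ⊆ insert k V := hT'.trans (Finset.subset_insert _ _)
  have s3 : insert k T ⊆ insert k V := Finset.insert_subset_insert _ hT
  have s4 : insert k T' ⊆ insert k V := Finset.insert_subset_insert _ hT'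
  have e1 := hf _ s1 _ s2
  have e2 := hf _ s3 _ s2
  have e3 := hf _ s1 _ s4
  have e4 := hf _ s3 _ s4
  rw [Finset.insert_union, Finset.insert_inter_of_notMem hkT'] at e2
  rw [Finset.union_insert, Finset.inter_insert_of_notMem hkT] at e3
  rw [← Finset.insert_inter_distrib, ← Finset.insert_union_distrib] at e4
  have m1 := le_max_left (f (T ∪ T')) (f (insert k (T ∪ T')) - r)
  have m2 := le_max_right (f (T ∪ T')) (f (insert k (T ∪ T')) - r)
  have m3 := le_max_left (f (T ∩ T')) (f (insert k (T ∩ T')) - r)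
  have m4 := le_max_right (f (T ∩ T')) (f (insert k (T ∩ T')) - r)
  rcases max_cases (f T) (f (insert k T) - r) with ⟨h, -⟩ | ⟨h, -⟩ <;>
    rcases max_cases (f T') (f (insert k T') - r) with ⟨h', -⟩ | ⟨h', -⟩ <;>
    rw [h, h'] <;> linarith

/-- The uncrossing step for a weight that can be given to one more element. -/
theorem lower_le_upper {α : Type*} [DecidableEq α] {lo hi : α → ℝ} {V : Finset α} {k : α}
    (hk : k ∉ V) {f g : Finset α → ℝ}
    (hf : ∀ T ⊆ insert k V, ∀ T' ⊆ insert k V, f T + f T' ≤ f (T ∪ T') + f (T ∩ T'))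
    (hg : ∀ T ⊆ insert k V, ∀ T' ⊆ insert k V, g (T ∪ T') + g (T ∩ T') ≤ g T + g T')
    (hbox : ∀ i ∈ V, lo i ≤ hi i)
    (hfg : ∀ T ⊆ insert k V, ∀ U ⊆ insert k V,
      f T + ∑ i ∈ insert k V, boxGap lo hi T U i ≤ g U)
    {T T' U U' : Finset α} (hT : T ⊆ V) (hT' : T' ⊆ V) (hU : U ⊆ V) (hU' : U' ⊆ V) :
    f (insert k T) + ∑ i ∈ V, boxGap lo hi T U i - g U ≤
      g (insert k U') - f T' - ∑ i ∈ V, boxGap lo hi T' U' i := by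
  have hkT : k ∉ T := fun h => hk (hT h)
  have hkT' : k ∉ T' := fun h => hk (hT' h)
  have hkU : k ∉ U := fun h => hk (hU h)
  have hkU' : k ∉ U' := fun h => hk (hU' h)
  have sub : ∀ {W : Finset α}, W ⊆ V → W ⊆ insert k V :=
    fun h => h.trans (Finset.subset_insert _ _)
  have ins : ∀ {W : Finset α}, W ⊆ V → insert k W ⊆ insert k V :=
    fun h => Finset.insert_subset_insert _ h
  -- After uncrossing, `k` lies in both unions and in neither intersection, so its own gap vanishes.
  have e1 := hf _ (ins hT) _ (sub hT')
  have e2 := hg _ (sub hU) _ (ins hU')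
  rw [Finset.insert_union, Finset.insert_inter_of_notMem hkT'] at e1
  rw [Finset.union_insert, Finset.inter_insert_of_notMem hkU] at e2
  have e3 := hfg _ (ins (Finset.union_subset hT hT')) _ (ins (Finset.union_subset hU hU'))
  have e4 := hfg (T ∩ T') (sub (Finset.inter_subset_left.trans hT)) (U ∩ U')
    (sub (Finset.inter_subset_left.trans hU))
  rw [Finset.sum_insert hk] at e3 e4
  have z3 : boxGap lo hi (insert k (T ∪ T')) (insert k (U ∪ U')) k = 0 := by simp [boxGap]
  have z4 : boxGap lo hi (T ∩ T') (U ∩ U') k = 0 := by simp [boxGap, hkT, hkU]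
  have c3 : ∑ i ∈ V, boxGap lo hi (insert k (T ∪ T')) (insert k (U ∪ U')) i =
      ∑ i ∈ V, boxGap lo hi (T ∪ T') (U ∪ U') i :=
    sum_boxGap_congr lo hi (by grind) (by grind)
  have e5 : ∑ i ∈ V, boxGap lo hi T U i + ∑ i ∈ V, boxGap lo hi T' U' i ≤
      ∑ i ∈ V, boxGap lo hi (T ∪ T') (U ∪ U') i +
        ∑ i ∈ V, boxGap lo hi (T ∩ T') (U ∩ U') i := by
    rw [← Finset.sum_add_distrib, ← Finset.sum_add_distrib]
    exact Finset.sum_le_sum fun i hi' => boxGap_uncross (hbox i hi') _ _ _ _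
  rw [z3, c3] at e3
  rw [z4] at e4
  linarith

/-- Weights are fixed one element at a time; `f` and `g` stay general because each choice contracts
both. The gap condition is also necessary, since `z(T) - z(U) = z(T \ U) - z(U \ T)`. -/
theorem exists_modular_between_aux {α : Type*} [DecidableEq α] (lo hi : α → ℝ) (V : Finset α) :
    ∀ f g : Finset α → ℝ, f ∅ = 0 → g ∅ = 0 →
    (∀ T ⊆ V, ∀ T' ⊆ V, f T + f T' ≤ f (T ∪ T') + f (T ∩ T')) →
    (∀ T ⊆ V, ∀ T' ⊆ V, g (T ∪ T') + g (T ∩ T') ≤ g T + g T') →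
    (∀ i ∈ V, lo i ≤ hi i) →
    (∀ T ⊆ V, ∀ U ⊆ V, f T + ∑ i ∈ V, boxGap lo hi T U i ≤ g U) →
    ∃ z : α → ℝ, (∀ i ∈ V, lo i ≤ z i ∧ z i ≤ hi i) ∧
      ∀ T ⊆ V, f T ≤ ∑ i ∈ T, z i ∧ ∑ i ∈ T, z i ≤ g T := by
  induction V using Finset.induction_on with
  | empty =>
    intro f g hf0 hg0 _ _ _ _
    refine ⟨fun _ => 0, by simp, fun T hT => ?_⟩
    rw [Finset.subset_empty.1 hT]
    simp [hf0, hg0]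
  | insert k V hk ih =>
    intro f g hf0 hg0 hf hg hbox hfg
    have sub : ∀ {W : Finset α}, W ⊆ V → W ⊆ insert k V :=
      fun h => h.trans (Finset.subset_insert _ _)
    have ins : ∀ {W : Finset α}, W ⊆ V → insert k W ⊆ insert k V :=
      fun h => Finset.insert_subset_insert _ h
    have hboxV : ∀ i ∈ V, lo i ≤ hi i := fun i h => hbox i (Finset.mem_insert_of_mem h)
    have hgap : ∀ {T U T' U' : Finset α}, (∀ i ∈ V, (i ∈ T ↔ i ∈ T')) →
        (∀ i ∈ V, (i ∈ U ↔ i ∈ U')) →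
        ∑ i ∈ V, boxGap lo hi T U i = ∑ i ∈ V, boxGap lo hi T' U' i :=
      fun h h' => sum_boxGap_congr lo hi h h'
    have hlower : ∀ T ⊆ V, ∀ U ⊆ V,
        f (insert k T) + ∑ i ∈ V, boxGap lo hi T U i - g U ≤ hi k := by
      intro T hT U hU
      have hkU : k ∉ U := fun h => hk (hU h)
      have e := hfg _ (ins hT) _ (sub hU)
      rw [Finset.sum_insert hk, hgap (T' := T) (U' := U) (by grind) (by grind)] at e
      have : boxGap lo hi (insert k T) U k = -hi k := by simp [boxGap, hkU]
      linarith
    have hupper : ∀ T ⊆ V, ∀ U ⊆ V,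
        lo k ≤ g (insert k U) - f T - ∑ i ∈ V, boxGap lo hi T U i := by
      intro T hT U hU
      have hkT : k ∉ T := fun h => hk (hT h)
      have e := hfg _ (sub hT) _ (ins hU)
      rw [Finset.sum_insert hk, hgap (T' := T) (U' := U) (by grind) (by grind)] at e
      have : boxGap lo hi T (insert k U) k = lo k := by simp [boxGap, hkT]
      linarith
    -- These bounds on the weight of `k` are its box and the mixed inequalities that the contracted
    -- pair must satisfy.
    obtain ⟨r, hr1, hr2⟩ := exists_between_of_forall_le
      (s := {a | a = lo k ∨ ∃ T ⊆ V, ∃ U ⊆ V,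
        a = f (insert k T) + ∑ i ∈ V, boxGap lo hi T U i - g U})
      (t := {a | a = hi k ∨ ∃ T ⊆ V, ∃ U ⊆ V,
        a = g (insert k U) - f T - ∑ i ∈ V, boxGap lo hi T U i})
      ⟨_, Or.inl rfl⟩ ⟨_, Or.inl rfl⟩ (by
        rintro _ (rfl | ⟨T, hT, U, hU, rfl⟩) _ (rfl | ⟨T', hT', U', hU', rfl⟩)
        · exact hbox k (Finset.mem_insert_self _ _)
        · exact hupper _ hT' _ hU'
        · exact hlower _ hT _ hU
        · exact lower_le_upper hk hf hg hboxV hfg hT hT' hU hU')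
    have r_lo : lo k ≤ r := hr1 (Or.inl rfl)
    have r_hi : r ≤ hi k := hr2 (Or.inl rfl)
    have r1 : ∀ T ⊆ V, ∀ U ⊆ V, f (insert k T) + ∑ i ∈ V, boxGap lo hi T U i - g U ≤ r :=
      fun T hT U hU => hr1 (Or.inr ⟨T, hT, U, hU, rfl⟩)
    have r2 : ∀ T ⊆ V, ∀ U ⊆ V, r ≤ g (insert k U) - f T - ∑ i ∈ V, boxGap lo hi T U i :=
      fun T hT U hU => hr2 (Or.inr ⟨T, hT, U, hU, rfl⟩)
    have hempty : ∑ i ∈ V, boxGap lo hi ∅ ∅ i = 0 := by simp [boxGap]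
    have f_k := r1 ∅ (Finset.empty_subset _) ∅ (Finset.empty_subset _)
    have g_k := r2 ∅ (Finset.empty_subset _) ∅ (Finset.empty_subset _)
    obtain ⟨z, hz1, hz2⟩ := ih (fun T => max (f T) (f (insert k T) - r))
      (fun T => min (g T) (g (insert k T) - r))
      (by rw [max_eq_left (by linarith), hf0]) (by rw [min_eq_left (by linarith), hg0])
      (fun T hT T' hT' => supermodular_contract hk hf r hT hT')
      -- Submodularity of the minimum is contraction of `-g` with weight `-r`.
      (fun T hT T' hT' => by
        have h := supermodular_contract hk (f := fun W => -g W)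
          (fun W hW W' hW' => by have := hg W hW W' hW'; linarith) (-r) hT hT'
        have key : ∀ W : Finset α, max (-g W) (-g (insert k W) - -r) =
            -min (g W) (g (insert k W) - r) := fun W => by
          rw [← max_neg_neg, neg_sub, sub_neg_eq_add, neg_add_eq_sub]
        simp only [key] at h
        linarith)
      hboxV
      (fun T hT U hU => by
        have hkT : k ∉ T := fun h => hk (hT h)
        have hkU : k ∉ U := fun h => hk (hU h)
        have e1 := hfg _ (sub hT) _ (sub hU)
        have e2 := hfg _ (ins hT) _ (ins hU)
        rw [Finset.sum_insert hk] at e1 e2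
        rw [hgap (T' := T) (U' := U) (by grind) (by grind)] at e2
        have z1 : boxGap lo hi T U k = 0 := by simp [boxGap, hkT, hkU]
        have z2 : boxGap lo hi (insert k T) (insert k U) k = 0 := by simp [boxGap]
        have e3 := r1 T hT U hU
        have e4 := r2 T hT U hU
        rw [← le_sub_iff_add_le]
        -- Both sides without `k` or both with it: the old gap condition. Mixed: the choice of `r`.
        refine max_le ?_ ?_ <;> rw [le_sub_iff_add_le] <;> refine le_min ?_ ?_ <;> linarith)
    have hne : ∀ {i}, i ∈ V → i ≠ k := fun h h' => hk (h' ▸ h)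
    refine ⟨Function.update z k r, fun i hi' => ?_, fun T hT => ?_⟩
    · rcases Finset.mem_insert.1 hi' with rfl | hi'
      · simpa using ⟨r_lo, r_hi⟩
      · rw [Function.update_of_ne (hne hi')]
        exact hz1 i hi'
    · have hsum : ∀ W ⊆ V, ∑ i ∈ W, Function.update z k r i = ∑ i ∈ W, z i := fun W hW =>
        Finset.sum_congr rfl fun i hi' => Function.update_of_ne (hne (hW hi')) _ _
      by_cases hkT : k ∈ T
      · have hW : T.erase k ⊆ V := by
          rw [← Finset.subset_insert_iff]; exact hT
        obtain ⟨h1, h2⟩ := hz2 _ hW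
        rw [Finset.insert_erase hkT] at h1 h2
        have h3 := (le_max_right _ _).trans h1
        have h4 := h2.trans (min_le_right _ _)
        rw [← Finset.add_sum_erase _ _ hkT, hsum _ hW, Function.update_self]
        constructor <;> linarith
      · have hW : T ⊆ V := (Finset.subset_insert_iff_of_notMem hkT).1 hT
        obtain ⟨h1, h2⟩ := hz2 _ hW
        rw [hsum _ hW]
        exact ⟨(le_max_left _ _).trans h1, h2.trans (min_le_left _ _)⟩

/-- A sandwich theorem with bounds: there is a modular function between a supermodular `f` and a
submodular `g` whose weights lie between `lo` and `hi`. -/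
theorem exists_modular_between {α : Type*} [Fintype α] [DecidableEq α] (lo hi : α → ℝ)
    (f g : Finset α → ℝ) (hf0 : f ∅ = 0) (hg0 : g ∅ = 0) (hf : IsSupermodular f)
    (hg : IsSupermodular fun T => -g T) (hbox : ∀ i, lo i ≤ hi i)
    (hfg : ∀ T U, f T + ∑ i ∈ U \ T, lo i ≤ g U + ∑ i ∈ T \ U, hi i) :
    ∃ z : α → ℝ, (∀ i, lo i ≤ z i ∧ z i ≤ hi i) ∧
      ∀ T, f T ≤ ∑ i ∈ T, z i ∧ ∑ i ∈ T, z i ≤ g T := by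
  obtain ⟨z, hz1, hz2⟩ := exists_modular_between_aux lo hi Finset.univ f g hf0 hg0
    (fun T _ T' _ => hf T T')
    (fun T _ T' _ => by have := hg T T'; linarith)
    (fun i _ => hbox i)
    (fun T _ U _ => by
      rw [sum_boxGap lo hi (Finset.subset_univ T) (Finset.subset_univ U)]
      linarith [hfg T U])
  exact ⟨z, fun i => hz1 i (Finset.mem_univ i), fun T => hz2 T (Finset.subset_univ T)⟩

/-! ### From block sums to individual quantities -/

/-- A vector of block sums within the bounds comes from a vector within the bounds. -/
theorem exists_of_block_sums {L ι : Type*} (A : ι → Finset L)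
    (hA : ∀ l, ∃ τ, l ∈ A τ) (hA_disj : ∀ τ σ : ι, τ ≠ σ → Disjoint (A τ) (A σ))
    (a b : L → ℝ) (hab : ∀ l, a l ≤ b l) (s : ι → ℝ)
    (hs : ∀ τ, ∑ l ∈ A τ, a l ≤ s τ ∧ s τ ≤ ∑ l ∈ A τ, b l) :
    ∃ z : L → ℝ, (∀ l, a l ≤ z l ∧ z l ≤ b l) ∧ ∀ τ, ∑ l ∈ A τ, z l = s τ := by
  -- One interpolation parameter serves a whole block.
  have hθ : ∀ τ, ∃ θ : ℝ, 0 ≤ θ ∧ θ ≤ 1 ∧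
      ∑ l ∈ A τ, (a l + θ * (b l - a l)) = s τ := by
    intro τ
    obtain ⟨h1, h2⟩ := hs τ
    simp only [Finset.sum_add_distrib, ← Finset.mul_sum, Finset.sum_sub_distrib]
    rcases (h1.trans h2).eq_or_lt with h | h
    · exact ⟨0, le_rfl, zero_le_one, by linarith⟩
    · have hpos := sub_pos.2 h
      refine ⟨(s τ - ∑ l ∈ A τ, a l) / (∑ l ∈ A τ, b l - ∑ l ∈ A τ, a l),
        div_nonneg (by linarith) hpos.le, (div_le_one hpos).2 (by linarith), ?_⟩
      rw [div_mul_cancel₀ _ hpos.ne']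
      ring
  choose θ h0 h1 hθ using hθ
  choose ty hty using hA
  have hty' : ∀ τ, ∀ l ∈ A τ, ty l = τ := fun τ l hl => by
    by_contra h
    exact Finset.disjoint_left.1 (hA_disj _ _ h) (hty l) hl
  refine ⟨fun l => a l + θ (ty l) * (b l - a l), fun l => ⟨?_, ?_⟩, fun τ => ?_⟩
  · have := mul_nonneg (h0 (ty l)) (sub_nonneg.2 (hab l))
    linarith
  · have := mul_le_mul_of_nonneg_right (h1 (ty l)) (sub_nonneg.2 (hab l))
    linarith
  · rw [← hθ τ]
    exact Finset.sum_congr rfl fun l hl => by simp only [hty' τ l hl]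

/-! ### Convex costs: exchange inequality and continuity -/

/-- If `z = p x + q y`, then `w = q x + p y`; the two convexity inequalities add up. -/
theorem ConvexOn.add_le_add_of_mem_segment {c : ℝ≥0 → ℝ≥0} (hc : ConvexOn ℝ≥0 Set.univ c)
    {x y z w : ℝ≥0} (h1 : min x y ≤ z) (h2 : z ≤ max x y) (h : z + w = x + y) :
    c z + c w ≤ c x + c y := by
  wlog hxy : x ≤ y generalizing x y
  · rw [add_comm (c x)]
    exact this (by rwa [min_comm]) (by rwa [max_comm]) (by rw [h, add_comm]) (le_of_not_ge hxy)
  rw [min_eq_left hxy] at h1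
  rw [max_eq_right hxy] at h2
  have hz : (z : ℝ) ∈ segment ℝ (x : ℝ) y := by
    rw [segment_eq_Icc (NNReal.coe_le_coe.2 hxy)]
    exact ⟨NNReal.coe_le_coe.2 h1, NNReal.coe_le_coe.2 h2⟩
  obtain ⟨p, q, hp, hq, hpq, hz⟩ := hz
  lift p to ℝ≥0 using hp
  lift q to ℝ≥0 using hq
  replace hpq : p + q = 1 := by exact_mod_cast hpq
  obtain rfl : p • x + q • y = z := by
    rw [smul_eq_mul, smul_eq_mul] at hz ⊢
    exact_mod_cast hz
  have hw : w = q • x + p • y := by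
    apply add_left_cancel (a := p • x + q • y)
    rw [h]
    calc x + y = (p + q) • x + (p + q) • y := by rw [hpq, one_smul, one_smul]
      _ = _ := by simp only [smul_eq_mul]; ring
  have e1 := hc.2 (Set.mem_univ x) (Set.mem_univ y) zero_le zero_le hpq
  have e2 := hc.2 (Set.mem_univ x) (Set.mem_univ y) zero_le zero_le (by rw [add_comm, hpq])
  rw [hw]
  calc _ ≤ (p • c x + q • c y) + (q • c x + p • c y) := add_le_add e1 e2
    _ = (p + q) • c x + (p + q) • c y := by simp only [smul_eq_mul]; ring
    _ = _ := by rw [hpq, one_smul, one_smul]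

/-- Monotonicity makes the extension by `c 0` to negative reals convex, so `0` becomes an interior
point and a jump there is impossible. -/
theorem ConvexOn.continuous_of_monotone_nnreal {c : ℝ≥0 → ℝ≥0} (hc : ConvexOn ℝ≥0 Set.univ c)
    (hm : Monotone c) : Continuous c := by
  have hC : ConvexOn ℝ Set.univ fun r : ℝ => (c r.toNNReal : ℝ) := by
    refine ⟨convex_univ, fun r _ s _ p q hp hq hpq => ?_⟩
    lift p to ℝ≥0 using hp
    lift q to ℝ≥0 using hq
    have h1 : (p • r + q • s : ℝ).toNNReal ≤ p • r.toNNReal + q • s.toNNReal := by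
      rw [Real.toNNReal_le_iff_le_coe]
      push_cast [smul_eq_mul, NNReal.smul_def]
      exact add_le_add (mul_le_mul_of_nonneg_left (Real.le_coe_toNNReal r) p.2)
        (mul_le_mul_of_nonneg_left (Real.le_coe_toNNReal s) q.2)
    have h2 := hc.2 (Set.mem_univ r.toNNReal) (Set.mem_univ s.toNNReal) zero_le zero_le
      (by exact_mod_cast hpq)
    have h3 := (hm h1).trans h2
    exact_mod_cast h3
  have hcont := (hC.continuousOn isOpen_univ).comp_continuous NNReal.continuous_coe
    fun _ => Set.mem_univ _
  refine NNReal.isEmbedding_coe.continuous_iff.2 ?_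
  simpa [Function.comp_def] using hcont

/-! ### Attainment and exchange in the market -/

section Market

variable {L : Type*} [DecidableEq L] {t : ℕ}

theorem isCompact_marketFeasible (A : Fin t → Finset L) (M : Finset (Fin t) → ℝ≥0)
    (X : L → ℝ≥0) (S : Finset L) : IsCompact (marketFeasible A M X S) := by
  refine (isCompact_Icc (a := (0 : L → ℝ≥0)) (b := X)).of_isClosed_subset ?_
    fun x hx => ⟨fun l => zero_le, hx.2.1⟩
  simp only [marketFeasible, Set.ofPred_and, Set.ofPred_forall]
  refine .inter (isClosed_iInter fun T => isClosed_le continuous_const (by fun_prop))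
    (.inter (isClosed_iInter fun l => isClosed_le (by fun_prop) continuous_const)
      (isClosed_iInter fun l => isClosed_iInter fun _ => isClosed_eq (by fun_prop)
        continuous_const))

theorem marketValue_le {A : Fin t → Finset L} {M : Finset (Fin t) → ℝ≥0} {X : L → ℝ≥0}
    (c : L → ℝ≥0 → ℝ≥0) {S : Finset L} {x : L → ℝ≥0} (hx : x ∈ marketFeasible A M X S) :
    marketValue A M X c S ≤ ((∑ l ∈ S, c l (x l) : ℝ≥0) : ℝ≥0∞) :=
  iInf₂_le x hx

theorem exists_eq_marketValue {A : Fin t → Finset L} {M : Finset (Fin t) → ℝ≥0} {X : L → ℝ≥0}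
    {c : L → ℝ≥0 → ℝ≥0} (hc : ∀ l, Continuous (c l)) {S : Finset L}
    (hS : (marketFeasible A M X S).Nonempty) :
    ∃ x ∈ marketFeasible A M X S,
      marketValue A M X c S = ((∑ l ∈ S, c l (x l) : ℝ≥0) : ℝ≥0∞) := by
  obtain ⟨x, hx, hmin⟩ := (isCompact_marketFeasible A M X S).exists_isMinOn hS
    (f := fun x => ∑ l ∈ S, c l (x l))
    (continuous_finsetSum _ fun l _ => (hc l).comp (continuous_apply l)).continuousOn
  refine ⟨x, hx, (marketValue_le c hx).antisymm (le_iInf₂ fun y hy => ?_)⟩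
  exact_mod_cast hmin hy

theorem marketFeasible.cost_eq_sum_univ [Fintype L] {A : Fin t → Finset L}
    {M : Finset (Fin t) → ℝ≥0} {X : L → ℝ≥0} {c : L → ℝ≥0 → ℝ≥0} (hc : ∀ l, c l 0 = 0)
    {S : Finset L} {x : L → ℝ≥0} (hx : x ∈ marketFeasible A M X S) :
    ∑ l ∈ S, c l (x l) = ∑ l, c l (x l) :=
  Finset.sum_subset (Finset.subset_univ S) fun l _ hl => by rw [hx.2.2 l hl, hc]

/-- The exchange property of the market: allocations for `S ∪ R` and `S ∩ R` can be rearranged into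
allocations for `S` and `R`, each quantity staying between the two given ones. -/
theorem marketFeasible.exchange {A : Fin t → Finset L}
    (hA_disj : ∀ τ σ : Fin t, τ ≠ σ → Disjoint (A τ) (A σ)) (hA : ∀ l, ∃ τ, l ∈ A τ)
    {M : Finset (Fin t) → ℝ≥0} (hM_empty : M ∅ = 0) (hM : IsSupermodular M)
    {X : L → ℝ≥0} {S R : Finset L} {x y : L → ℝ≥0}
    (hx : x ∈ marketFeasible A M X (S ∪ R)) (hy : y ∈ marketFeasible A M X (S ∩ R)) :
    ∃ z ∈ marketFeasible A M X S, ∃ w ∈ marketFeasible A M X R,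
      ∀ l, min (x l) (y l) ≤ z l ∧ z l ≤ max (x l) (y l) ∧ z l + w l = x l + y l := by
  have hsum : ∀ (v : L → ℝ) (T : Finset (Fin t)),
      ∑ l ∈ T.biUnion A, v l = ∑ τ ∈ T, ∑ l ∈ A τ, v l := fun v T =>
    Finset.sum_biUnion fun τ _ σ _ h => hA_disj τ σ h
  have hMx : ∀ T, (M T : ℝ) ≤ ∑ τ ∈ T, ∑ l ∈ A τ, (x l : ℝ) := fun T => by
    rw [← hsum]; exact_mod_cast hx.1 T
  have hMy : ∀ T, (M T : ℝ) ≤ ∑ τ ∈ T, ∑ l ∈ A τ, (y l : ℝ) := fun T => by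
    rw [← hsum]; exact_mod_cast hy.1 T
  have hMr : ∀ T U, (M T : ℝ) + M U ≤ M (T ∪ U) + M (T ∩ U) := fun T U => by
    exact_mod_cast hM T U
  have hy0 : ∀ l, l ∉ S ∨ l ∉ R → y l = 0 := fun l h => hy.2.2 l (by grind)
  have hx0 : ∀ l, l ∉ S → l ∉ R → x l = 0 := fun l h h' => hx.2.2 l (by grind)
  -- Off `S`, `z` must vanish; on `S \ R`, `w` must vanish and `y = 0`, forcing `z = x`. Only `S ∩
  -- R` leaves freedom.
  let a : L → ℝ := fun l => if l ∈ S then if l ∈ R then min (x l) (y l) else x l else 0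
  let b : L → ℝ := fun l => if l ∈ S then if l ∈ R then max (x l) (y l) else x l else 0
  have hab : ∀ l, a l ≤ b l := fun l => by
    simp only [a, b]
    split_ifs
    · exact min_le_max
    all_goals exact le_rfl
  have hax : ∀ l, a l ≤ x l := fun l => by
    simp only [a]
    split_ifs
    · exact min_le_left _ _
    · exact le_rfl
    · exact (x l).2
  have hyb : ∀ l, (y l : ℝ) ≤ b l := fun l => by
    simp only [b]
    split_ifs with h1 h2
    · exact le_max_right _ _
    · rw [hy0 l (Or.inr h2)]; exact (x l).2
    · rw [hy0 l (Or.inl h1)]; exact le_rfl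
  have hmin : ∀ l, min (x l : ℝ) (y l) ≤ a l := fun l => by
    simp only [a]
    split_ifs with h1 h2
    · exact le_rfl
    · exact min_le_left _ _
    · rw [hy0 l (Or.inl h1)]; exact min_le_right _ _
  have hmax : ∀ l, b l ≤ max (x l : ℝ) (y l) := fun l => by
    simp only [b]
    split_ifs with h1 h2
    · exact le_rfl
    · exact le_max_left _ _
    · exact (x l).2.trans (le_max_left _ _)
  obtain ⟨s, hs1, hs2⟩ := exists_modular_between
    (fun τ => ∑ l ∈ A τ, a l) (fun τ => ∑ l ∈ A τ, b l) (fun T => (M T : ℝ))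
    (fun T => ∑ τ ∈ T, (∑ l ∈ A τ, (x l : ℝ) + ∑ l ∈ A τ, (y l : ℝ)) - M T)
    (by simp [hM_empty]) (by simp [hM_empty]) hMr
    (fun T U => by
      have h1 := hMr T U
      have h2 := Finset.sum_union_inter (s₁ := T) (s₂ := U)
        (f := fun τ => ∑ l ∈ A τ, (x l : ℝ) + ∑ l ∈ A τ, (y l : ℝ))
      linarith)
    (fun τ => Finset.sum_le_sum fun l _ => hab l)
    -- Gap condition: `M T + M U ≤ M (T ∪ U) + M (T ∩ U) ≤ y(T ∪ U) + x(T ∩ U)`; then `y ≤ b` on `T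
    -- \ U` and `a ≤ x` on `U \ T`.
    (fun T U => by
      have h1 := hMr T U
      have h2 := hMy (T ∪ U)
      have h3 := hMx (T ∩ U)
      have h4 : ∑ τ ∈ U \ T, ∑ l ∈ A τ, a l ≤ ∑ τ ∈ U \ T, ∑ l ∈ A τ, (x l : ℝ) :=
        Finset.sum_le_sum fun τ _ => Finset.sum_le_sum fun l _ => hax l
      have h5 : ∑ τ ∈ T \ U, ∑ l ∈ A τ, (y l : ℝ) ≤ ∑ τ ∈ T \ U, ∑ l ∈ A τ, b l :=
        Finset.sum_le_sum fun τ _ => Finset.sum_le_sum fun l _ => hyb l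
      have h6 : ∑ τ ∈ T ∪ U, ∑ l ∈ A τ, (y l : ℝ) =
          ∑ τ ∈ T \ U, ∑ l ∈ A τ, (y l : ℝ) + ∑ τ ∈ U, ∑ l ∈ A τ, (y l : ℝ) := by
        rw [← Finset.sdiff_union_self_eq_union, Finset.sum_union Finset.sdiff_disjoint]
      have h7 : ∑ τ ∈ U, ∑ l ∈ A τ, (x l : ℝ) =
          ∑ τ ∈ T ∩ U, ∑ l ∈ A τ, (x l : ℝ) + ∑ τ ∈ U \ T, ∑ l ∈ A τ, (x l : ℝ) := by
        rw [Finset.inter_comm, Finset.sum_inter_add_sum_sdiff]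
      rw [Finset.sum_add_distrib]
      linarith)
  obtain ⟨z, hz1, hz2⟩ := exists_of_block_sums A hA hA_disj a b hab s hs1
  have hz0 : ∀ l, 0 ≤ z l := fun l =>
    (le_min (x l).2 (y l).2).trans ((hmin l).trans (hz1 l).1)
  have hz_max : ∀ l, z l ≤ max (x l : ℝ) (y l) := fun l => (hz1 l).2.trans (hmax l)
  have hz_min : ∀ l, min (x l : ℝ) (y l) ≤ z l := fun l => (hmin l).trans (hz1 l).1
  have hw0 : ∀ l, 0 ≤ x l + y l - z l := fun l => by
    have h1 := hz_max l
    have h2 := max_le_add_of_nonneg (x l).2 (y l).2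
    exact sub_nonneg.2 (h1.trans h2)
  have hzM : ∀ T, ∑ l ∈ T.biUnion A, z l = ∑ τ ∈ T, s τ := fun T => by
    rw [hsum]; exact Finset.sum_congr rfl fun τ _ => hz2 τ
  have hcap : ∀ l, max (x l : ℝ) (y l) ≤ X l := fun l =>
    max_le (by exact_mod_cast hx.2.1 l) (by exact_mod_cast hy.2.1 l)
  obtain ⟨u, hu⟩ : ∃ u : L → ℝ≥0, ∀ l, (u l : ℝ) = z l :=
    ⟨fun l => (z l).toNNReal, fun l => Real.coe_toNNReal _ (hz0 l)⟩
  obtain ⟨w, hw⟩ : ∃ w : L → ℝ≥0, ∀ l, (w l : ℝ) = x l + y l - z l :=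
    ⟨fun l => (x l + y l - z l : ℝ).toNNReal, fun l => Real.coe_toNNReal _ (hw0 l)⟩
  refine ⟨u, ⟨fun T => ?_, fun l => ?_, fun l hl => ?_⟩,
    w, ⟨fun T => ?_, fun l => ?_, fun l hl => ?_⟩, fun l => ⟨?_, ?_, ?_⟩⟩
  · rw [← NNReal.coe_le_coe, NNReal.coe_sum]
    simp only [hu]
    exact (hs2 T).1.trans (hzM T).ge
  · rw [← NNReal.coe_le_coe, hu]
    exact (hz_max l).trans (hcap l)
  · rw [← NNReal.coe_inj, hu]
    have h := hz1 l
    simp only [a, b, if_neg hl] at h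
    exact le_antisymm h.2 h.1
  · rw [← NNReal.coe_le_coe, NNReal.coe_sum]
    simp only [hw]
    have h := (hs2 T).2
    rw [Finset.sum_sub_distrib, hzM, Finset.sum_add_distrib, hsum, hsum]
    rw [Finset.sum_add_distrib] at h
    linarith
  · rw [← NNReal.coe_le_coe, hw]
    have h1 := hz_min l
    have h2 := hcap l
    have h3 := min_add_max (x l : ℝ) (y l)
    linarith
  · rw [← NNReal.coe_inj, hw, hy0 l (Or.inr hl)]
    have h := hz1 l
    by_cases hS : l ∈ S
    · simp only [a, b, if_pos hS, if_neg hl] at h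
      rw [le_antisymm h.2 h.1]
      simp
    · simp only [a, b, if_neg hS] at h
      rw [le_antisymm h.2 h.1, hx0 l hS hl]
      simp
  · rw [← NNReal.coe_le_coe, NNReal.coe_min, hu]
    exact hz_min l
  · rw [← NNReal.coe_le_coe, NNReal.coe_max, hu]
    exact hz_max l
  · rw [← NNReal.coe_inj, NNReal.coe_add, NNReal.coe_add, hu, hw]
    ring

end Market

/-! ### Supermodularity of the market value -/

theorem theorem5 {L : Type*} [Fintype L] [DecidableEq L] {t : ℕ}
    (A : Fin t → Finset L)
    (hA_disj : ∀ τ σ : Fin t, τ ≠ σ → Disjoint (A τ) (A σ))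
    (hA_cover : Finset.univ.biUnion A = Finset.univ)
    (M : Finset (Fin t) → ℝ≥0) (hM_empty : M ∅ = 0)
    (hM_mono : Monotone M) (hM_super : IsSupermodular M)
    (X : L → ℝ≥0)
    (c : L → ℝ≥0 → ℝ≥0) (hc_zero : ∀ l, c l 0 = 0)
    (hc_mono : ∀ l, Monotone (c l))
    (hc_convex : ∀ l, ConvexOn ℝ≥0 Set.univ (c l)) :
    (∀ S : Finset L, (marketFeasible A M X S).Nonempty →
      ∃ x ∈ marketFeasible A M X S,
        marketValue A M X c S = ((∑ l ∈ S, c l (x l) : ℝ≥0) : ℝ≥0∞)) ∧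
    IsSupermodular (marketValue A M X c) := by
  have hc_cont : ∀ l, Continuous (c l) := fun l =>
    (hc_convex l).continuous_of_monotone_nnreal (hc_mono l)
  refine ⟨fun S hS => exists_eq_marketValue hc_cont hS, fun S R => ?_⟩
  have hA : ∀ l, ∃ τ, l ∈ A τ := fun l => by
    have h := hA_cover.ge (Finset.mem_univ l)
    simpa using h
  -- If either problem is infeasible, the right-hand side is `∞`.
  rcases (marketFeasible A M X (S ∪ R)).eq_empty_or_nonempty with h | h
  · simp [marketValue, h]
  rcases (marketFeasible A M X (S ∩ R)).eq_empty_or_nonempty with h' | h'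
  · simp [marketValue, h']
  obtain ⟨x, hx, hJx⟩ := exists_eq_marketValue hc_cont h
  obtain ⟨y, hy, hJy⟩ := exists_eq_marketValue hc_cont h'
  obtain ⟨z, hz, w, hw, hzw⟩ := marketFeasible.exchange hA_disj hA hM_empty hM_super hx hy
  rw [hJx, hJy]
  refine (add_le_add (marketValue_le c hz) (marketValue_le c hw)).trans ?_
  rw [marketFeasible.cost_eq_sum_univ hc_zero hx, marketFeasible.cost_eq_sum_univ hc_zero hy, marketFeasible.cost_eq_sum_univ hc_zero hz,
    marketFeasible.cost_eq_sum_univ hc_zero hw, ← ENNReal.coe_add, ← ENNReal.coe_add, ENNReal.coe_le_coe,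
    ← Finset.sum_add_distrib, ← Finset.sum_add_distrib]
  exact Finset.sum_le_sum fun l _ =>
    (hc_convex l).add_le_add_of_mem_segment (hzw l).1 (hzw l).2.1 (hzw l).2.2
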